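/- Let $E$ be a Dedekind complete (real) vector lattice with a weak order unit $e$. A conditional expectation on $E$ is a linear operator $T:E\to E$ that is a strictly positive (i.e. $Tx\ge 0$ for $x\ge 0$, and $x\geq 0$, $Tx=0$ imply $x=0$), order continuous projection whose range is a Dedekind complete Riesz subspace and which fixes some weak order unit. Let $T$ be a conditional expectation on $E$ with $Te=e$, and let $(T_n)_{n\ge 1}$ be a filtration with $T_1=T$, that is, a sequence of conditional expectations on $E$ with $T_iT_j=T_jT_i=T_{\min(i,j)}$ for all $i,j\ge 1$. Let $(f_n)_{n\ge1}$ be a martingale, i.e. a sequence in $E$ with $T_nf_{n+1}=f_n$ for all $n\ge 1$, and assume that it is $T$-bounded, i.e. there is $M\in E$ with $T|f_n|\le M$ for all $n$. Let $E^u$ be the universal completion of $E$ (the Dedekind complete and laterally complete vector lattice that contains $E$ as an order dense Riesz subspace) and let $(E^u)_s$ be the sup-completion of $E^u$, in which every nonempty subset has a supremum. Then the maximal function $$f^*:=\sup_{n\ge 1}|f_n|,$$ where the supremum is taken in $(E^u)_s$, belongs to $E^u$. -/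

import Mathlib

namespace RieszSpace

/-- A weak order unit: a positive element `e` whose only disjoint element is `0`. -/
def IsWeakOrderUnit {E : Type*} [Lattice E] [AddCommGroup E] (e : E) : Prop :=
  0 ≤ e ∧ ∀ x : E, e ⊓ |x| = 0 → x = 0

/-- Order continuity of a positive operator: `T D ↓ 0` for every downward directed `D ↓ 0`. -/
def IsOrderContinuous {E : Type*} [Lattice E] [AddCommGroup E] [Module ℝ E]
    (T : E →ₗ[ℝ] E) : Prop :=
  ∀ D : Set E, D.Nonempty → DirectedOn (· ≥ ·) D → IsGLB D 0 → IsGLB (T '' D) 0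

/-- A conditional expectation operator: a strictly positive order continuous projection onto a
Dedekind complete Riesz subspace, which fixes some weak order unit. -/
structure IsConditionalExpectation {E : Type*} [Lattice E] [AddCommGroup E] [Module ℝ E]
    (T : E →ₗ[ℝ] E) : Prop where
  nonneg : ∀ x : E, 0 ≤ x → 0 ≤ T x
  strictly_pos : ∀ x : E, 0 ≤ x → T x = 0 → x = 0
  order_continuous : IsOrderContinuous T
  idempotent : ∀ x : E, T (T x) = T x
  range_sup : ∀ x y : E, T x ⊔ T y ∈ Set.range T
  range_inf : ∀ x y : E, T x ⊓ T y ∈ Set.range T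
  range_dedekind_complete : ∀ A : Set (Set.range T), A.Nonempty → BddAbove A → ∃ s, IsLUB A s
  exists_fixed_unit : ∃ e : E, IsWeakOrderUnit e ∧ T e = e

/-- A filtration starting at `T`: conditional expectations `S 0 = T, S 1, S 2, …` with
`S i ∘ S j = S (min i j)`. (The index starts at `0`.) -/
structure IsFiltration {E : Type*} [Lattice E] [AddCommGroup E] [Module ℝ E]
    (T : E →ₗ[ℝ] E) (S : ℕ → E →ₗ[ℝ] E) : Prop where
  condExp : ∀ n, IsConditionalExpectation (S n)
  zero_eq : S 0 = T
  comp_eq : ∀ i j x, S i (S j x) = S (min i j) x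

/-- `(f n)` is a martingale with respect to `(S n)`. -/
def IsMartingale {E : Type*} [Lattice E] [AddCommGroup E] [Module ℝ E]
    (S : ℕ → E →ₗ[ℝ] E) (f : ℕ → E) : Prop :=
  ∀ n, S n (f (n + 1)) = f n

/-- `(f n)` is `T`-bounded: the sequence `(T |f n|)` is order bounded in `E`. -/
def IsTBounded {E : Type*} [Lattice E] [AddCommGroup E] [Module ℝ E]
    (T : E →ₗ[ℝ] E) (f : ℕ → E) : Prop :=
  ∃ M : E, ∀ n, T |f n| ≤ M

/-- Lateral completeness: every nonempty set of mutually disjoint positive elements has a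
supremum. -/
def IsLaterallyComplete (U : Type*) [Lattice U] [AddCommGroup U] : Prop :=
  ∀ A : Set U, A.Nonempty → (∀ a ∈ A, 0 ≤ a) → (∀ a ∈ A, ∀ b ∈ A, a ≠ b → a ⊓ b = 0) →
    ∃ s, IsLUB A s

/-- `U`, together with the embedding `j : E → U`, is a universal completion of `E`: `U` is
universally complete (Dedekind complete and laterally complete) and `j` is a Riesz isomorphism
of `E` onto an order dense Riesz subspace of `U`. Universal completions are unique up to a Riesz
isomorphism that fixes `E`. -/
structure IsUniversalCompletion {E U : Type*} [Lattice E] [AddCommGroup E] [Module ℝ E]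
    [ConditionallyCompleteLattice U] [AddCommGroup U] [Module ℝ U] (j : E →ₗ[ℝ] U) : Prop where
  laterally_complete : IsLaterallyComplete U
  injective : Function.Injective j
  map_sup : ∀ x y : E, j (x ⊔ y) = j x ⊔ j y
  map_inf : ∀ x y : E, j (x ⊓ y) = j x ⊓ j y
  order_dense : ∀ u : U, 0 < u → ∃ x : E, 0 < j x ∧ j x ≤ u

/-- The sup-completion of a Dedekind complete Riesz space `U`, as an ordered set. An element `x`
of it is represented by the set of all `y` in `U` with `y ≤ x`; the sets which occur are the
nonempty lower sets that are closed under all suprema which exist in `U`. -/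
@[ext]
structure SupCompletion (U : Type*) [Lattice U] where
  carrier : Set U
  nonempty : carrier.Nonempty
  lower : IsLowerSet carrier
  sup_mem : ∀ (B : Set U) (s : U), B ⊆ carrier → B.Nonempty → IsLUB B s → s ∈ carrier

namespace SupCompletion

variable {U : Type*} [Lattice U]

instance : PartialOrder (SupCompletion U) :=
  PartialOrder.lift carrier fun _ _ h => SupCompletion.ext h

theorem le_def {x y : SupCompletion U} : x ≤ y ↔ x.carrier ⊆ y.carrier := Iff.rfl

/-- The canonical embedding of `U` into its sup-completion. -/
def of (u : U) : SupCompletion U where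
  carrier := Set.Iic u
  nonempty := ⟨u, le_refl u⟩
  lower := isLowerSet_Iic u
  sup_mem := fun _ _ hB _ hs => hs.2 fun _ hb => hB hb

theorem of_le_iff {u : U} {x : SupCompletion U} : of u ≤ x ↔ u ∈ x.carrier :=
  ⟨fun h => h (le_refl u), fun h _ hv => x.lower hv h⟩

theorem of_le_of {u v : U} : of u ≤ of v ↔ u ≤ v := of_le_iff

/-- The supremum, in the sup-completion, of a nonempty family. -/
def sup {I : Type*} [Nonempty I] (F : I → SupCompletion U) : SupCompletion U where
  carrier := {u | ∀ y : SupCompletion U, (∀ i, F i ≤ y) → u ∈ y.carrier}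
  nonempty :=
    let ⟨u, hu⟩ := (F (Classical.arbitrary I)).nonempty
    ⟨u, fun _ hy => hy _ hu⟩
  lower := fun _ _ hba ha y hy => y.lower hba (ha y hy)
  sup_mem := fun B s hB hne hs y hy => y.sup_mem B s (fun _ hb => hB hb y hy) hne hs

theorem isLUB_sup {I : Type*} [Nonempty I] (F : I → SupCompletion U) :
    IsLUB (Set.range F) (sup F) := by
  constructor
  · rintro _ ⟨i, rfl⟩ u hu y hy
    exact hy i hu
  · intro y hy u hu
    exact hu y fun i => hy ⟨i, rfl⟩

/-- Every element is the supremum of the elements of `U` below it. -/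
theorem isLUB_of_le (x : SupCompletion U) : IsLUB (of '' {u | of u ≤ x}) x := by
  constructor
  · rintro _ ⟨u, hu, rfl⟩
    exact hu
  · intro y hy u hu
    exact of_le_iff.1 (hy ⟨u, of_le_iff.2 hu, rfl⟩)

end SupCompletion

/-- The maximal function `f* = sup |f n|`, formed in the sup-completion of `U`, of a sequence in
`E`, where `E` is embedded in `U` by `j`. -/
def maximalFunction {E U : Type*} [AddCommGroup E] [Module ℝ E] [Lattice U] [AddCommGroup U]
    [Module ℝ U] (j : E →ₗ[ℝ] U) (f : ℕ → E) : SupCompletion U :=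
  SupCompletion.sup fun n => SupCompletion.of |j (f n)|

end RieszSpace

/-!
A conditional expectation commutes with the band projections of the elements it fixes. Splitting
`a` according to the first time at which the submartingale `|f i|` exceeds `a` therefore yields
Doob's maximal inequality: if `T a = a`, the part of `a` where `sup |f i| > a` has `T`-image at most
`M`. For `a = n e` this leaves a component `r n` of `n e` on which every `|f i|` is at most `n e`,
with `T (n e - r n) ≤ M`. An element `z` disjoint from all `r n` satisfies
`n (e ⊓ |z|) ≤ n e - r n`, so `T (e ⊓ |z|) ≤ M / n` for all `n`, and strict positivity of `T` gives
`z = 0`. Hence the bands of the `r n` exhaust `E`. Cutting them down to disjoint bands and gluing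
the bounds `n e` over these by lateral completeness produces an upper bound of all `|f i|` in the
universal completion.
-/

namespace RieszSpace

open LatticeOrderedAddCommGroup (IsSolid)

section LatticeOrderedGroup

variable {E : Type*} [Lattice E] [AddCommGroup E]

theorem inf_eq_zero_mono {x x' z : E} (hx : 0 ≤ x) (hz : 0 ≤ z) (hxx' : x ≤ x')
    (h : x' ⊓ z = 0) : x ⊓ z = 0 :=
  le_antisymm (h ▸ inf_le_inf_right z hxx') (le_inf hx hz)

variable [IsOrderedAddMonoid E]

theorem eq_zero_of_abs_nonpos {x : E} (h : |x| ≤ 0) : x = 0 :=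
  le_antisymm ((le_abs_self x).trans h) (neg_nonpos.1 ((neg_le_abs x).trans h))

theorem add_inf_le_add_inf {x y z : E} (hx : 0 ≤ x) (hy : 0 ≤ y) (hz : 0 ≤ z) :
    (x + y) ⊓ z ≤ x ⊓ z + y ⊓ z := by
  rw [add_inf, inf_add, inf_add]
  refine le_inf (le_inf inf_le_left ?_) (le_inf ?_ ?_)
  · exact inf_le_right.trans (le_add_of_nonneg_right hy)
  · exact inf_le_right.trans (le_add_of_nonneg_left hx)
  · exact inf_le_right.trans (le_add_of_nonneg_left hz)

theorem add_inf_eq_zero {x y z : E} (hx : 0 ≤ x) (hy : 0 ≤ y) (hz : 0 ≤ z)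
    (hxz : x ⊓ z = 0) (hyz : y ⊓ z = 0) : (x + y) ⊓ z = 0 := by
  refine le_antisymm ?_ (le_inf (add_nonneg hx hy) hz)
  simpa only [hxz, hyz, add_zero] using add_inf_le_add_inf hx hy hz

theorem nsmul_inf_eq_zero {x z : E} (hx : 0 ≤ x) (hz : 0 ≤ z) (h : x ⊓ z = 0) (n : ℕ) :
    (n • x) ⊓ z = 0 := by
  induction n with
  | zero => rwa [zero_nsmul, inf_eq_left]
  | succ n ih =>
    rw [succ_nsmul]
    exact add_inf_eq_zero (nsmul_nonneg hx n) hx hz ih h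

theorem add_eq_sup_of_inf_eq_zero {x y : E} (h : x ⊓ y = 0) : x + y = x ⊔ y := by
  rw [← inf_add_sup x y, h, zero_add]

theorem inf_eq_zero_of_isLUB {B : Set E} {s z : E} (hs : IsLUB B s) (hs₀ : 0 ≤ s) (hz : 0 ≤ z)
    (h : ∀ y ∈ B, y ⊓ z = 0) : s ⊓ z = 0 := by
  refine le_antisymm ?_ (le_inf hs₀ hz)
  have hle : s ≤ s ⊔ z - z := hs.2 fun y hy => by
    rw [le_sub_iff_add_le, add_eq_sup_of_inf_eq_zero (h y hy)]
    exact sup_le_sup_right (hs.1 hy) z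
  rwa [le_sub_iff_add_le, ← inf_add_sup s z, add_le_iff_nonpos_left] at hle

theorem sum_inf_eq_zero {ι : Type*} {a : ι → E} {z : E} (ha : ∀ i, 0 ≤ a i) (hz : 0 ≤ z)
    {s : Finset ι} (h : ∀ i ∈ s, a i ⊓ z = 0) : (∑ i ∈ s, a i) ⊓ z = 0 := by
  classical
  induction s using Finset.induction_on with
  | empty => rwa [Finset.sum_empty, inf_eq_left]
  | insert i s hi ih =>
    rw [Finset.sum_insert hi]
    exact add_inf_eq_zero (ha i) (Finset.sum_nonneg fun k _ => ha k) hz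
      (h i (Finset.mem_insert_self i s)) (ih fun k hk => h k (Finset.mem_insert_of_mem hk))

theorem sum_le_of_pairwise_inf_eq_zero {ι : Type*} {a : ι → E} {u : E} (hu : 0 ≤ u)
    (ha : ∀ i, 0 ≤ a i) (hdisj : Pairwise fun i k => a i ⊓ a k = 0) (hau : ∀ i, a i ≤ u)
    (s : Finset ι) : ∑ i ∈ s, a i ≤ u := by
  classical
  induction s using Finset.induction_on with
  | empty => rwa [Finset.sum_empty]
  | insert i s hi ih =>
    have hsum : (∑ k ∈ s, a k) ⊓ a i = 0 :=
      sum_inf_eq_zero ha (ha i) fun k hk => hdisj (ne_of_mem_of_not_mem hk hi)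
    rw [Finset.sum_insert hi, add_comm, add_eq_sup_of_inf_eq_zero hsum]
    exact sup_le ih (hau i)

theorem isLUB_range_const_sub_iff {ι : Type*} {x : ι → E} {c s : E} :
    IsLUB (Set.range fun i => c - x i) (c - s) ↔ IsGLB (Set.range x) s := by
  simp only [isLUB_iff_le_iff, isGLB_iff_le_iff, mem_upperBounds, mem_lowerBounds,
    Set.forall_mem_range]
  constructor
  · intro h y
    simpa only [sub_le_sub_iff_left] using h (c - y)
  · intro h y
    simpa only [sub_le_comm] using h (c - y)

end LatticeOrderedGroup

section DisjointComplement

variable {E : Type*} [Lattice E] [AddCommGroup E] [Module ℝ E] [IsOrderedModule ℝ E]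

theorem abs_smul_le (c : ℝ) (x : E) : |c • x| ≤ |c| • |x| := by
  wlog hc : 0 ≤ c generalizing c
  · simpa only [neg_smul, abs_neg] using this (-c) (neg_nonneg.2 (le_of_not_ge hc))
  rw [abs_of_nonneg hc, abs_le', ← smul_neg]
  exact ⟨smul_le_smul_of_nonneg_left (le_abs_self x) hc,
    smul_le_smul_of_nonneg_left (neg_le_abs x) hc⟩

variable [IsOrderedAddMonoid E]

/-- The disjoint complement `Aᵈ` of a set `A`: all elements `x` with `|x| ⊓ |a| = 0` for every
`a ∈ A`. -/
def disjointComplement (A : Set E) : Submodule ℝ E where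
  carrier := {x | ∀ a ∈ A, |x| ⊓ |a| = 0}
  zero_mem' a _ := by rw [abs_zero, inf_eq_left]; exact abs_nonneg a
  add_mem' {x y} hx hy a ha :=
    inf_eq_zero_mono (abs_nonneg _) (abs_nonneg _) (abs_add_le x y)
      (add_inf_eq_zero (abs_nonneg x) (abs_nonneg y) (abs_nonneg a) (hx a ha) (hy a ha))
  smul_mem' c x hx a ha := by
    obtain ⟨n, hn⟩ := exists_nat_ge |c|
    have hle : |c • x| ≤ n • |x| := by
      rw [← Nat.cast_smul_eq_nsmul ℝ]
      exact (abs_smul_le c x).trans (smul_le_smul_of_nonneg_right hn (abs_nonneg x))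
    exact inf_eq_zero_mono (abs_nonneg _) (abs_nonneg _) hle
      (nsmul_inf_eq_zero (abs_nonneg x) (abs_nonneg a) (hx a ha) n)

theorem mem_disjointComplement {A : Set E} {x : E} :
    x ∈ disjointComplement A ↔ ∀ a ∈ A, |x| ⊓ |a| = 0 := Iff.rfl

theorem mem_disjointComplement_singleton {b x : E} :
    x ∈ disjointComplement {b} ↔ |x| ⊓ |b| = 0 := by
  simp only [mem_disjointComplement, Set.mem_singleton_iff, forall_eq]

theorem mem_disjointComplement_singleton_comm {b x : E} :
    x ∈ disjointComplement {b} ↔ b ∈ disjointComplement {x} := by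
  rw [mem_disjointComplement_singleton, mem_disjointComplement_singleton, inf_comm]

theorem isSolid_disjointComplement (A : Set E) : IsSolid (disjointComplement A : Set E) :=
  fun _ hx _ hyx a ha => inf_eq_zero_mono (abs_nonneg _) (abs_nonneg a) hyx (hx a ha)

theorem subset_disjointComplement_disjointComplement (A : Set E) :
    A ⊆ disjointComplement (disjointComplement A : Set E) := fun a ha x hx => by
  rw [inf_comm]
  exact hx a ha

theorem isLUB_mem_disjointComplement {A B : Set E} {s : E} (hs : IsLUB B s) (hs₀ : 0 ≤ s)
    (hB₀ : ∀ y ∈ B, 0 ≤ y) (hB : B ⊆ disjointComplement A) : s ∈ disjointComplement A := by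
  intro a ha
  rw [abs_of_nonneg hs₀]
  refine inf_eq_zero_of_isLUB hs hs₀ (abs_nonneg a) fun y hy => ?_
  rw [← abs_of_nonneg (hB₀ y hy)]
  exact hB hy a ha

/-- The principal band generated by `b`, in the form `{b}ᵈᵈ`. In an Archimedean space it is the
smallest band that contains `b`. -/
def principalBand (b : E) : Submodule ℝ E :=
  disjointComplement (disjointComplement {b} : Set E)

theorem abs_mem_principalBand (b : E) : |b| ∈ principalBand b :=
  isSolid_disjointComplement _ (subset_disjointComplement_disjointComplement {b} rfl) (abs_abs b).le

theorem disjoint_principalBand (b : E) : Disjoint (principalBand b) (disjointComplement {b}) := by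
  refine Submodule.disjoint_def.2 fun x hxdd hxd => eq_zero_of_abs_nonpos ?_
  rw [← hxdd x hxd, inf_idem]

theorem mem_principalBand_of_nonneg_of_le {b x : E} {n : ℕ} (hx : 0 ≤ x) (h : x ≤ n • |b|) :
    x ∈ principalBand b := by
  refine isSolid_disjointComplement _ (nsmul_mem (abs_mem_principalBand b) n) ?_
  rwa [abs_of_nonneg hx, abs_of_nonneg (hx.trans h)]

end DisjointComplement

section BandProjection

variable {E : Type*} [ConditionallyCompleteLattice E] [AddCommGroup E]

theorem isLUB_iSup_inf_nsmul (b x : E) :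
    IsLUB (Set.range fun n : ℕ => x ⊓ n • b) (⨆ n : ℕ, x ⊓ n • b) :=
  isLUB_ciSup ⟨x, Set.forall_mem_range.2 fun _ => inf_le_left⟩

variable [IsOrderedAddMonoid E]

theorem nonpos_of_forall_nsmul_le {w M : E} (h : ∀ n : ℕ, n • w ≤ M) : w ≤ 0 := by
  have hbdd : BddAbove (Set.range fun n : ℕ => n • w) := ⟨M, Set.forall_mem_range.2 h⟩
  have hle : (⨆ n : ℕ, n • w) ≤ (⨆ n : ℕ, n • w) - w := ciSup_le fun n => by
    rw [le_sub_iff_add_le, ← succ_nsmul]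
    exact le_ciSup hbdd (n + 1)
  rwa [le_sub_self_iff] at hle

theorem sub_iSup_inf_nsmul_inf_eq_zero {b x : E} (hb : 0 ≤ b) :
    (x - ⨆ n : ℕ, x ⊓ n • b) ⊓ b = 0 := by
  have hlub := isLUB_iSup_inf_nsmul b x
  set y := ⨆ n : ℕ, x ⊓ n • b
  have hyx : y ≤ x := hlub.2 (Set.forall_mem_range.2 fun _ => inf_le_left)
  refine le_antisymm ?_ (le_inf (sub_nonneg.2 hyx) hb)
  set z := (x - y) ⊓ b
  have hyz : y + z ≤ x := le_sub_iff_add_le'.1 inf_le_left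
  have hle : y ≤ y - z := hlub.2 <| Set.forall_mem_range.2 fun n => by
    have hn : x ⊓ n • b + z ≤ x ⊓ (n + 1) • b := by
      refine le_inf ((add_le_add_left (hlub.1 ⟨n, rfl⟩) z).trans hyz) ?_
      rw [succ_nsmul]
      exact add_le_add inf_le_right inf_le_right
    exact le_sub_iff_add_le.2 (hn.trans (hlub.1 ⟨n + 1, rfl⟩))
  rwa [le_sub_self_iff] at hle

variable [Module ℝ E] [IsOrderedModule ℝ E]

theorem iSup_inf_nsmul_mem_principalBand (b : E) {x : E} (hx : 0 ≤ x) :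
    ⨆ n : ℕ, x ⊓ n • |b| ∈ principalBand b := by
  have hlub := isLUB_iSup_inf_nsmul |b| x
  have hinf₀ (n : ℕ) : 0 ≤ x ⊓ n • |b| := le_inf hx (nsmul_nonneg (abs_nonneg b) n)
  exact isLUB_mem_disjointComplement hlub ((hinf₀ 0).trans (hlub.1 ⟨0, rfl⟩))
    (Set.forall_mem_range.2 hinf₀)
    (Set.range_subset_iff.2 fun n => mem_principalBand_of_nonneg_of_le (hinf₀ n) inf_le_right)

theorem sub_iSup_inf_nsmul_mem_disjointComplement (b x : E) :
    x - ⨆ n : ℕ, x ⊓ n • |b| ∈ disjointComplement {b} := by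
  have hle : ⨆ n : ℕ, x ⊓ n • |b| ≤ x := ciSup_le fun _ => inf_le_left
  rw [mem_disjointComplement_singleton, abs_of_nonneg (sub_nonneg.2 hle)]
  exact sub_iSup_inf_nsmul_inf_eq_zero (abs_nonneg b)

theorem isCompl_principalBand (b : E) : IsCompl (principalBand b) (disjointComplement {b}) := by
  have hpos {x : E} (hx : 0 ≤ x) : x ∈ principalBand b ⊔ disjointComplement {b} := by
    rw [← add_sub_cancel (⨆ n : ℕ, x ⊓ n • |b|) x]
    exact Submodule.add_mem_sup (iSup_inf_nsmul_mem_principalBand b hx)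
      (sub_iSup_inf_nsmul_mem_disjointComplement b x)
  refine ⟨disjoint_principalBand b, codisjoint_iff.2 (Submodule.eq_top_iff'.2 fun x => ?_)⟩
  rw [← posPart_sub_negPart x]
  exact sub_mem (hpos (posPart_nonneg x)) (hpos (negPart_nonneg x))

/-- The band projection `P_b` onto the principal band generated by `b`. -/
noncomputable def bandProj (b : E) : Module.End ℝ E :=
  (principalBand b).projection (disjointComplement {b}) (isCompl_principalBand b)

theorem bandProj_mem_principalBand (b x : E) : bandProj b x ∈ principalBand b :=
  Submodule.projection_apply_mem _ x

theorem bandProj_eq_zero_iff {b x : E} : bandProj b x = 0 ↔ x ∈ disjointComplement {b} :=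
  Submodule.projection_apply_eq_zero_iff _

theorem bandProj_eq_of_mem {b x y : E} (hy : y ∈ principalBand b)
    (hxy : x - y ∈ disjointComplement {b}) : bandProj b x = y := by
  have hPy : bandProj b y = y := Submodule.projection_apply_of_mem_left _ hy
  rw [← sub_add_cancel x y, map_add, bandProj_eq_zero_iff.2 hxy, zero_add, hPy]

theorem sub_bandProj_mem_disjointComplement (b x : E) :
    x - bandProj b x ∈ disjointComplement {b} := by
  rw [← bandProj_eq_zero_iff, map_sub, sub_eq_zero]
  exact (Submodule.projection_apply_of_mem_left _ (bandProj_mem_principalBand b x)).symm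

theorem isLUB_bandProj (b : E) {x : E} (hx : 0 ≤ x) :
    IsLUB (Set.range fun n : ℕ => x ⊓ n • |b|) (bandProj b x) := by
  rw [bandProj_eq_of_mem (iSup_inf_nsmul_mem_principalBand b hx)
    (sub_iSup_inf_nsmul_mem_disjointComplement b x)]
  exact isLUB_iSup_inf_nsmul |b| x

theorem bandProj_nonneg (b : E) {x : E} (hx : 0 ≤ x) : 0 ≤ bandProj b x :=
  (le_inf hx (zero_nsmul |b|).ge).trans ((isLUB_bandProj b hx).1 ⟨0, rfl⟩)

theorem bandProj_le_self (b : E) {x : E} (hx : 0 ≤ x) : bandProj b x ≤ x :=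
  (isLUB_bandProj b hx).2 (Set.forall_mem_range.2 fun _ => inf_le_left)

theorem monotone_bandProj (b : E) : Monotone (bandProj b) :=
  (monotone_iff_map_nonneg _).2 fun _ => bandProj_nonneg b

theorem abs_bandProj_le (b x : E) : |bandProj b x| ≤ |x| := by
  refine le_trans (abs_le'.2 ⟨monotone_bandProj b (le_abs_self x), ?_⟩)
    (bandProj_le_self b (abs_nonneg x))
  rw [← map_neg]
  exact monotone_bandProj b (neg_le_abs x)

theorem bandProj_mem_of_mem_disjointComplement {A : Set E} {x : E} (b : E)
    (hx : x ∈ disjointComplement A) : bandProj b x ∈ disjointComplement A :=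
  isSolid_disjointComplement A hx (abs_bandProj_le b x)

theorem principalBand_sub_bandProj {e : E} (he : IsWeakOrderUnit e) (b : E) :
    principalBand (e - bandProj b e) = disjointComplement {b} := by
  have hc := sub_bandProj_mem_disjointComplement b e
  have hle : disjointComplement {e - bandProj b e} ≤ principalBand b := by
    intro z hz
    have hd := sub_bandProj_mem_disjointComplement b z
    have hc' : z - bandProj b z ∈ disjointComplement {e - bandProj b e} :=
      sub_mem hz (bandProj_mem_of_mem_disjointComplement b hz)
    have he' : e ⊓ |z - bandProj b z| = 0 := by
      have hsum := add_inf_eq_zero (abs_nonneg _) (abs_nonneg _) (abs_nonneg _)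
        ((inf_comm _ _).trans (mem_disjointComplement_singleton.1 hc'))
        (bandProj_mem_principalBand b e _ hd)
      rwa [abs_of_nonneg (sub_nonneg.2 (bandProj_le_self b he.1)),
        abs_of_nonneg (bandProj_nonneg b he.1), sub_add_cancel] at hsum
    rw [sub_eq_zero.1 (he.2 _ he')]
    exact bandProj_mem_principalBand b z
  refine le_antisymm (fun x hx => ?_) fun x hx z hz => ?_
  · exact mem_disjointComplement_singleton.2 (hx b (mem_disjointComplement_singleton_comm.1 hc))
  · rw [inf_comm]
    exact hle hz x hx

end BandProjection

section Layer

variable {E : Type*} [ConditionallyCompleteLattice E] [AddCommGroup E] [IsOrderedAddMonoid E]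
  [Module ℝ E] [IsOrderedModule ℝ E]

/-- The operator `(1 - P_{b (n - 1)}) ⋯ (1 - P_{b 0})`, which removes from an element its components
in the bands generated by `b 0, …, b (n - 1)`. -/
noncomputable def residual (b : ℕ → E) : ℕ → Module.End ℝ E
  | 0 => 1
  | n + 1 => (1 - bandProj (b n)) * residual b n

/-- The operator which extracts from an element the part that lies in the band generated by `b n`
but not in those generated by `b 0, …, b (n - 1)`. For `b i = (g i - a)⁺` this is the restriction
to the event that `n` is the first time at which `g` exceeds `a`. -/
noncomputable def layer (b : ℕ → E) (n : ℕ) : Module.End ℝ E :=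
  bandProj (b n) * residual b n

theorem residual_zero_apply (b : ℕ → E) (x : E) : residual b 0 x = x := rfl

theorem residual_succ_apply (b : ℕ → E) (n : ℕ) (x : E) :
    residual b (n + 1) x = residual b n x - bandProj (b n) (residual b n x) := rfl

theorem layer_apply (b : ℕ → E) (n : ℕ) (x : E) :
    layer b n x = bandProj (b n) (residual b n x) := rfl

theorem sum_layer_apply (b : ℕ → E) (x : E) (N : ℕ) :
    ∑ n ∈ Finset.range N, layer b n x = x - residual b N x := by
  induction N with
  | zero => rw [Finset.sum_range_zero, residual_zero_apply, sub_self]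
  | succ N ih =>
    rw [Finset.sum_range_succ, ih, layer_apply, residual_succ_apply]
    abel

theorem residual_nonneg (b : ℕ → E) {x : E} (hx : 0 ≤ x) (n : ℕ) : 0 ≤ residual b n x := by
  induction n with
  | zero => exact hx
  | succ n ih => exact sub_nonneg.2 (bandProj_le_self (b n) ih)

theorem layer_nonneg (b : ℕ → E) {x : E} (hx : 0 ≤ x) (n : ℕ) : 0 ≤ layer b n x :=
  bandProj_nonneg (b n) (residual_nonneg b hx n)

theorem antitone_residual (b : ℕ → E) {x : E} (hx : 0 ≤ x) : Antitone fun n => residual b n x :=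
  antitone_nat_of_succ_le fun n => sub_le_self _ (layer_nonneg b hx n)

theorem residual_mem_of_mem_disjointComplement (b : ℕ → E) {A : Set E} {x : E}
    (hx : x ∈ disjointComplement A) (n : ℕ) : residual b n x ∈ disjointComplement A := by
  induction n with
  | zero => exact hx
  | succ n ih => exact sub_mem ih (bandProj_mem_of_mem_disjointComplement (b n) ih)

theorem residual_mem_disjointComplement (b : ℕ → E) (x : E) {i n : ℕ} (h : i < n) :
    residual b n x ∈ disjointComplement {b i} := by
  induction n, h using Nat.le_induction with
  | base => exact sub_bandProj_mem_disjointComplement (b i) (residual b i x)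
  | succ n _ ih =>
    exact sub_mem ih (bandProj_mem_of_mem_disjointComplement (b n) ih)

theorem layer_inf_layer_eq_zero (b : ℕ → E) {x y : E} (hx : 0 ≤ x) (hy : 0 ≤ y) {m n : ℕ}
    (h : m ≠ n) : layer b m x ⊓ layer b n y = 0 := by
  wlog hmn : m < n generalizing m n x y
  · rw [inf_comm]
    exact this hy hx h.symm (h.lt_or_gt.resolve_left hmn)
  have hn : layer b n y ∈ disjointComplement {b m} :=
    bandProj_mem_of_mem_disjointComplement (b n) (residual_mem_disjointComplement b y hmn)
  have hm : layer b m x ∈ principalBand (b m) := bandProj_mem_principalBand (b m) _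
  simpa only [abs_of_nonneg, layer_nonneg, hx, hy] using hm (layer b n y) hn

theorem layer_eq_zero_of_mem_disjointComplement {b : ℕ → E} {n : ℕ} {x : E}
    (hx : x ∈ disjointComplement {b n}) : layer b n x = 0 :=
  bandProj_eq_zero_iff.2 (residual_mem_of_mem_disjointComplement b hx n)

theorem monotone_layer (b : ℕ → E) (n : ℕ) : Monotone (layer b n) :=
  (monotone_iff_map_nonneg _).2 fun _ hx => layer_nonneg b hx n

theorem layer_le_layer_of_posPart_sub_mem {b : ℕ → E} {n : ℕ} {x y : E}
    (h : (x - y)⁺ ∈ disjointComplement {b n}) : layer b n x ≤ layer b n y := by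
  have hle : layer b n (x - y) ≤ layer b n (x - y)⁺ := monotone_layer b n (le_posPart _)
  rwa [layer_eq_zero_of_mem_disjointComplement h, map_sub, sub_nonpos] at hle

theorem isGLB_residual {r : ℕ → E} (hr : disjointComplement (Set.range r) = ⊥) {x : E}
    (hx : 0 ≤ x) : IsGLB (Set.range fun n => residual r n x) 0 := by
  refine ⟨Set.forall_mem_range.2 (residual_nonneg r hx), fun y hy => ?_⟩
  have hle (n : ℕ) : y⁺ ≤ residual r n x := sup_le (hy ⟨n, rfl⟩) (residual_nonneg r hx n)
  have hmem : y⁺ ∈ disjointComplement (Set.range r) := by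
    rintro _ ⟨n, rfl⟩
    refine mem_disjointComplement_singleton.1 (isSolid_disjointComplement _
      (residual_mem_disjointComplement r x n.lt_succ_self) ?_)
    exact abs_le_abs_of_nonneg (posPart_nonneg y) (hle (n + 1))
  rw [hr, Submodule.mem_bot] at hmem
  exact posPart_eq_zero.1 hmem

end Layer

section ConditionalExpectation

variable {E : Type*} [Lattice E] [AddCommGroup E] [Module ℝ E] {S : E →ₗ[ℝ] E}

namespace IsConditionalExpectation

theorem map_inf_of_fixed (hS : IsConditionalExpectation S) {x y : E} (hx : S x = x)
    (hy : S y = y) : S (x ⊓ y) = x ⊓ y := by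
  obtain ⟨z, hz⟩ := hS.range_inf x y
  rw [hx, hy] at hz
  rw [← hz, hS.idempotent]

theorem map_sup_of_fixed (hS : IsConditionalExpectation S) {x y : E} (hx : S x = x)
    (hy : S y = y) : S (x ⊔ y) = x ⊔ y := by
  obtain ⟨z, hz⟩ := hS.range_sup x y
  rw [hx, hy] at hz
  rw [← hz, hS.idempotent]

theorem map_abs_of_fixed (hS : IsConditionalExpectation S) {x : E} (hx : S x = x) :
    S |x| = |x| :=
  hS.map_sup_of_fixed hx (by rw [map_neg, hx])

theorem map_posPart_of_fixed (hS : IsConditionalExpectation S) {x : E} (hx : S x = x) :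
    S x⁺ = x⁺ :=
  hS.map_sup_of_fixed hx (map_zero S)

variable [IsOrderedAddMonoid E]

theorem monotone (hS : IsConditionalExpectation S) : Monotone S :=
  (monotone_iff_map_nonneg S).2 hS.nonneg

theorem abs_map_le (hS : IsConditionalExpectation S) (x : E) : |S x| ≤ S |x| := by
  refine abs_le'.2 ⟨hS.monotone (le_abs_self x), ?_⟩
  rw [← map_neg]
  exact hS.monotone (neg_le_abs x)

theorem isLUB_map (hS : IsConditionalExpectation S) {ι : Type*} [Preorder ι] [IsDirectedOrder ι]
    [Nonempty ι] {x : ι → E} {s : E} (hx : Monotone x) (hs : IsLUB (Set.range x) s) :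
    IsLUB (Set.range fun i => S (x i)) (S s) := by
  have hanti : Antitone fun i => s - x i := fun _ _ h => sub_le_sub_left (hx h) s
  have hglb : IsGLB (Set.range fun i => s - x i) 0 := by
    rw [← isLUB_range_const_sub_iff (c := s)]
    simpa only [sub_sub_cancel, sub_zero] using hs
  have hmap := hS.order_continuous _ (Set.range_nonempty _)
    (directedOn_range.2 hanti.directed_ge) hglb
  rw [← Set.range_comp, ← isLUB_range_const_sub_iff (c := S s)] at hmap
  simpa only [Function.comp_apply, map_sub, sub_sub_cancel, sub_zero] using hmap

end IsConditionalExpectation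

end ConditionalExpectation

section CommuteBandProjection

variable {E : Type*} [ConditionallyCompleteLattice E] [AddCommGroup E] [IsOrderedAddMonoid E]
  [Module ℝ E] [IsOrderedModule ℝ E] {S : E →ₗ[ℝ] E}

namespace IsConditionalExpectation

theorem isLUB_map_bandProj (hS : IsConditionalExpectation S) (b : E) {x : E} (hx : 0 ≤ x) :
    IsLUB (Set.range fun n : ℕ => S (x ⊓ n • |b|)) (S (bandProj b x)) :=
  hS.isLUB_map (fun _ _ h => inf_le_inf_left x (nsmul_le_nsmul_left (abs_nonneg b) h))
    (isLUB_bandProj b hx)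

theorem map_bandProj_of_fixed (hS : IsConditionalExpectation S) {b x : E} (hb : S b = b)
    (hx : S x = x) (hx₀ : 0 ≤ x) : S (bandProj b x) = bandProj b x := by
  refine (hS.isLUB_map_bandProj b hx₀).unique ?_
  have hinf (n : ℕ) : S (x ⊓ n • |b|) = x ⊓ n • |b| :=
    hS.map_inf_of_fixed hx (by rw [map_nsmul, hS.map_abs_of_fixed hb])
  simpa only [hinf] using isLUB_bandProj b hx₀

theorem map_mem_principalBand (hS : IsConditionalExpectation S) {b x : E} (hb : S b = b)
    (hx : x ∈ principalBand b) : S x ∈ principalBand b := by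
  have habs : |x| ∈ principalBand b := isSolid_disjointComplement _ hx (abs_abs x).le
  have hlub := hS.isLUB_map_bandProj b (abs_nonneg x)
  rw [bandProj_eq_of_mem habs (by rw [sub_self]; exact zero_mem _)] at hlub
  have hS₀ := hS.nonneg _ (abs_nonneg x)
  have hnonneg (n : ℕ) : 0 ≤ S (|x| ⊓ n • |b|) :=
    hS.nonneg _ (le_inf (abs_nonneg x) (nsmul_nonneg (abs_nonneg b) n))
  have hle (n : ℕ) : S (|x| ⊓ n • |b|) ≤ n • |b| := by
    simpa only [map_nsmul, hS.map_abs_of_fixed hb] using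
      hS.monotone (inf_le_right : |x| ⊓ n • |b| ≤ n • |b|)
  have hSabs : S |x| ∈ principalBand b :=
    isLUB_mem_disjointComplement hlub hS₀ (Set.forall_mem_range.2 hnonneg)
      (Set.range_subset_iff.2 fun n => mem_principalBand_of_nonneg_of_le (hnonneg n) (hle n))
  refine isSolid_disjointComplement _ hSabs ?_
  rw [abs_of_nonneg hS₀]
  exact hS.abs_map_le x

theorem map_mem_disjointComplement (hS : IsConditionalExpectation S) {b x : E} (hb : S b = b)
    (hx : x ∈ disjointComplement {b}) : S x ∈ disjointComplement {b} := by
  obtain ⟨e, he, hSe⟩ := hS.exists_fixed_unit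
  have hfixed : S (e - bandProj b e) = e - bandProj b e := by
    rw [map_sub, hSe, hS.map_bandProj_of_fixed hb hSe he.1]
  rw [← principalBand_sub_bandProj he] at hx ⊢
  exact hS.map_mem_principalBand hfixed hx

theorem commute_bandProj (hS : IsConditionalExpectation S) {b : E} (hb : S b = b) :
    Commute S (bandProj b) := by
  refine LinearMap.ext fun x => (bandProj_eq_of_mem ?_ ?_).symm
  · exact hS.map_mem_principalBand hb (bandProj_mem_principalBand b x)
  · rw [Module.End.mul_apply, ← map_sub]
    exact hS.map_mem_disjointComplement hb (sub_bandProj_mem_disjointComplement b x)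

theorem commute_residual (hS : IsConditionalExpectation S) {b : ℕ → E} {n : ℕ}
    (hb : ∀ i < n, S (b i) = b i) : Commute S (residual b n) := by
  induction n with
  | zero => exact Commute.one_right S
  | succ n ih =>
    exact ((Commute.one_right S).sub_right (hS.commute_bandProj (hb n n.lt_succ_self))).mul_right
      (ih fun i hi => hb i (hi.trans n.lt_succ_self))

theorem commute_layer (hS : IsConditionalExpectation S) {b : ℕ → E} {n : ℕ}
    (hb : ∀ i ≤ n, S (b i) = b i) : Commute S (layer b n) :=
  (hS.commute_bandProj (hb n le_rfl)).mul_right (hS.commute_residual fun i hi => hb i hi.le)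

end IsConditionalExpectation

end CommuteBandProjection

section Submartingale

variable {E : Type*} [Lattice E] [AddCommGroup E] [Module ℝ E] {T : E →ₗ[ℝ] E}
  {S : ℕ → E →ₗ[ℝ] E}

/-- `(g n)` is a submartingale with respect to `(S n)`: each `g n` lies in the range of `S n`, and
`g n ≤ S n (g (n + 1))`. -/
structure IsSubmartingale (S : ℕ → E →ₗ[ℝ] E) (g : ℕ → E) : Prop where
  fixed : ∀ n, S n (g n) = g n
  le_map_succ : ∀ n, g n ≤ S n (g (n + 1))

namespace IsFiltration

theorem isConditionalExpectation (hS : IsFiltration T S) : IsConditionalExpectation T :=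
  hS.zero_eq ▸ hS.condExp 0

theorem map_map_of_le (hS : IsFiltration T S) {k n : ℕ} (h : k ≤ n) (x : E) :
    S k (S n x) = S k x := by
  rw [hS.comp_eq, min_eq_left h]

theorem map_eq_self_of_le (hS : IsFiltration T S) {k n : ℕ} (h : k ≤ n) {x : E}
    (hx : S k x = x) : S n x = x := by
  rw [← hx, hS.comp_eq, min_eq_right h]

theorem map_initial_map (hS : IsFiltration T S) (n : ℕ) (x : E) : T (S n x) = T x := by
  rw [← hS.zero_eq, hS.map_map_of_le n.zero_le]

theorem map_eq_self_of_initial (hS : IsFiltration T S) (n : ℕ) {x : E} (hx : T x = x) :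
    S n x = x :=
  hS.map_eq_self_of_le n.zero_le (by rwa [hS.zero_eq])

end IsFiltration

variable [IsOrderedAddMonoid E]

theorem IsMartingale.isSubmartingale_abs {f : ℕ → E} (hf : IsMartingale S f)
    (hS : IsFiltration T S) : IsSubmartingale S fun n => |f n| where
  fixed n := (hS.condExp n).map_abs_of_fixed <| by rw [← hf n, (hS.condExp n).idempotent]
  le_map_succ n := by
    rw [← hf n]
    exact (hS.condExp n).abs_map_le _

theorem IsSubmartingale.le_map {g : ℕ → E} (hg : IsSubmartingale S g) (hS : IsFiltration T S)
    {k n : ℕ} (h : k ≤ n) : g k ≤ S k (g n) := by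
  induction n, h using Nat.le_induction with
  | base => exact (hg.fixed k).ge
  | succ n h ih =>
    calc g k ≤ S k (g n) := ih
      _ ≤ S k (S n (g (n + 1))) := (hS.condExp k).monotone (hg.le_map_succ n)
      _ = S k (g (n + 1)) := hS.map_map_of_le h _

end Submartingale

section MaximalInequality

variable {E : Type*} [ConditionallyCompleteLattice E] [AddCommGroup E] [IsOrderedAddMonoid E]
  [Module ℝ E] [IsOrderedModule ℝ E] {T : E →ₗ[ℝ] E}

theorem layer_posPart_sub_le (g : ℕ → E) (a : E) (k : ℕ) :
    layer (fun i => (g i - a)⁺) k a ≤ layer (fun i => (g i - a)⁺) k (g k) := by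
  refine layer_le_layer_of_posPart_sub_mem ?_
  rw [mem_disjointComplement_singleton, abs_of_nonneg (posPart_nonneg _),
    abs_of_nonneg (posPart_nonneg _), ← neg_sub, posPart_neg, inf_comm]
  exact posPart_inf_negPart_eq_zero _

namespace IsSubmartingale

variable {S : ℕ → E →ₗ[ℝ] E} {g : ℕ → E}

theorem map_layer_le (hg : IsSubmartingale S g) (hS : IsFiltration T S) {a : E} (ha : T a = a)
    {k N : ℕ} (h : k ≤ N) :
    T (layer (fun i => (g i - a)⁺) k a) ≤ T (layer (fun i => (g i - a)⁺) k (g N)) := by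
  have hfixed (i : ℕ) (hi : i ≤ k) : S k (g i - a)⁺ = (g i - a)⁺ :=
    (hS.condExp k).map_posPart_of_fixed <| by
      rw [map_sub, hS.map_eq_self_of_le hi (hg.fixed i), hS.map_eq_self_of_initial k ha]
  have hcomm := (hS.condExp k).commute_layer hfixed
  set L := layer (fun i => (g i - a)⁺) k
  calc T (L a) ≤ T (L (S k (g N))) := hS.isConditionalExpectation.monotone <|
        (layer_posPart_sub_le g a k).trans (monotone_layer _ k (hg.le_map hS h))
    _ = T (S k (L (g N))) := congrArg T (LinearMap.congr_fun hcomm.eq (g N)).symm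
    _ = T (L (g N)) := hS.map_initial_map k _

/-- Doob's maximal inequality: `a - residual b N a` is the part of `a` on the event that
`g i > a` for some `i < N`. -/
theorem map_sub_residual_le (hg : IsSubmartingale S g) (hS : IsFiltration T S) {a : E}
    (ha : T a = a) {N : ℕ} (hN : 0 ≤ g N) :
    T (a - residual (fun i => (g i - a)⁺) N a) ≤ T (g N) := by
  set b : ℕ → E := fun i => (g i - a)⁺
  calc T (a - residual b N a) = ∑ k ∈ Finset.range N, T (layer b k a) := by
        rw [← sum_layer_apply, map_sum]
    _ ≤ ∑ k ∈ Finset.range N, T (layer b k (g N)) :=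
        Finset.sum_le_sum fun k hk => hg.map_layer_le hS ha (Finset.mem_range.1 hk).le
    _ = T (g N - residual b N (g N)) := by rw [← map_sum, sum_layer_apply]
    _ ≤ T (g N) :=
        hS.isConditionalExpectation.monotone (sub_le_self _ (residual_nonneg b hN N))

theorem exists_forall_posPart_sub_mem_disjointComplement (hg : IsSubmartingale S g)
    (hS : IsFiltration T S) (hg₀ : ∀ n, 0 ≤ g n) {M : E} (hM : ∀ n, T (g n) ≤ M) {a : E}
    (ha₀ : 0 ≤ a) (ha : T a = a) :
    ∃ r, 0 ≤ r ∧ r ≤ a ∧ T (a - r) ≤ M ∧ ∀ i, (g i - a)⁺ ∈ disjointComplement {r} := by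
  set b : ℕ → E := fun i => (g i - a)⁺
  have hglb : IsGLB (Set.range fun N => residual b N a) (⨅ N, residual b N a) :=
    isGLB_ciInf ⟨0, Set.forall_mem_range.2 (residual_nonneg b ha₀)⟩
  set r := ⨅ N, residual b N a
  have hr₀ : 0 ≤ r := hglb.2 (Set.forall_mem_range.2 (residual_nonneg b ha₀))
  refine ⟨r, hr₀, hglb.1 ⟨0, rfl⟩, ?_, fun i => mem_disjointComplement_singleton_comm.1 ?_⟩
  · have hmono : Monotone fun N => a - residual b N a :=
      fun _ _ h => sub_le_sub_left (antitone_residual b ha₀ h) a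
    have hlub := hS.isConditionalExpectation.isLUB_map hmono (isLUB_range_const_sub_iff.2 hglb)
    exact hlub.2 (Set.forall_mem_range.2 fun N =>
      (hg.map_sub_residual_le hS ha (hg₀ N)).trans (hM N))
  · exact isSolid_disjointComplement _ (residual_mem_disjointComplement b a i.lt_succ_self)
      (abs_le_abs_of_nonneg hr₀ (hglb.1 ⟨i + 1, rfl⟩))

end IsSubmartingale

theorem IsConditionalExpectation.disjointComplement_range_eq_bot (hT : IsConditionalExpectation T)
    {e M : E} (he : IsWeakOrderUnit e) {r : ℕ → E} (hr₀ : ∀ n, 0 ≤ r n) (hr : ∀ n, r n ≤ n • e)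
    (hM : ∀ n, T (n • e - r n) ≤ M) : disjointComplement (Set.range r) = ⊥ := by
  refine (Submodule.eq_bot_iff _).2 fun z hz => he.2 z ?_
  set w := e ⊓ |z|
  have hw : 0 ≤ w := le_inf he.1 (abs_nonneg z)
  have hle (n : ℕ) : n • w ≤ n • e - r n := by
    have hzr : |z| ⊓ r n = 0 := by simpa only [abs_of_nonneg (hr₀ n)] using hz (r n) ⟨n, rfl⟩
    have hdisj : n • w ⊓ r n = 0 :=
      nsmul_inf_eq_zero hw (hr₀ n) (inf_eq_zero_mono hw (hr₀ n) inf_le_right hzr) n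
    rw [le_sub_iff_add_le, add_eq_sup_of_inf_eq_zero hdisj]
    exact sup_le (nsmul_le_nsmul_right inf_le_left n) (hr n)
  have hTw : T w ≤ 0 := nonpos_of_forall_nsmul_le fun n => by
    rw [← map_nsmul]
    exact (hT.monotone (hle n)).trans (hM n)
  exact hT.strictly_pos w hw (le_antisymm hTw (hT.nonneg w hw))

end MaximalInequality

section UniversalCompletion

theorem IsLaterallyComplete.exists_forall_sum_le {U : Type*} [Lattice U] [AddCommGroup U]
    [IsOrderedAddMonoid U] (hU : IsLaterallyComplete U) {ι : Type*} [Nonempty ι] {a : ι → U}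
    (ha : ∀ i, 0 ≤ a i) (hdisj : Pairwise fun i k => a i ⊓ a k = 0) :
    ∃ u, ∀ s : Finset ι, ∑ i ∈ s, a i ≤ u := by
  obtain ⟨u, hu⟩ := hU (Set.range a) (Set.range_nonempty a) (Set.forall_mem_range.2 ha) <| by
    rintro _ ⟨i, rfl⟩ _ ⟨k, rfl⟩ hne
    exact hdisj (ne_of_apply_ne a hne)
  have hau (i : ι) : a i ≤ u := hu.1 ⟨i, rfl⟩
  have hu₀ : 0 ≤ u := (ha (Classical.arbitrary ι)).trans (hau _)
  exact ⟨u, sum_le_of_pairwise_inf_eq_zero hu₀ ha hdisj hau⟩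

namespace IsUniversalCompletion

variable {E U : Type*} [AddCommGroup E] [Module ℝ E] [ConditionallyCompleteLattice U]
  [AddCommGroup U] [Module ℝ U]

section Lattice

variable [Lattice E] {j : E →ₗ[ℝ] U}

theorem map_le_map_iff (hj : IsUniversalCompletion j) {x y : E} : j x ≤ j y ↔ x ≤ y := by
  rw [← inf_eq_left, ← hj.map_inf, hj.injective.eq_iff, inf_eq_left]

theorem map_nonneg (hj : IsUniversalCompletion j) {x : E} (hx : 0 ≤ x) : 0 ≤ j x := by
  rwa [← map_zero j, hj.map_le_map_iff]

theorem map_abs (hj : IsUniversalCompletion j) (x : E) : j |x| = |j x| := by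
  rw [abs, abs, hj.map_sup, map_neg]

theorem isGLB_map_zero (hj : IsUniversalCompletion j) {ι : Type*} {x : ι → E}
    (hx : IsGLB (Set.range x) 0) : IsGLB (Set.range fun i => j (x i)) 0 := by
  have hx₀ (i : ι) : 0 ≤ j (x i) := hj.map_nonneg (hx.1 ⟨i, rfl⟩)
  refine ⟨Set.forall_mem_range.2 hx₀, fun v hv => posPart_nonpos.1 ?_⟩
  by_contra hpos
  obtain ⟨y, hy₀, hyv⟩ := hj.order_dense v⁺
    ((posPart_nonneg v).lt_of_ne fun h => hpos h.ge)
  have hyx (i : ι) : y ≤ x i := hj.map_le_map_iff.1 (hyv.trans (sup_le (hv ⟨i, rfl⟩) (hx₀ i)))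
  have hy : j y ≤ j 0 := hj.map_le_map_iff.2 (hx.2 (Set.forall_mem_range.2 hyx))
  rw [map_zero] at hy
  exact hy.not_gt hy₀

end Lattice

variable [ConditionallyCompleteLattice E] [IsOrderedAddMonoid E] [IsOrderedModule ℝ E]
  [IsOrderedAddMonoid U] {j : E →ₗ[ℝ] U}

theorem exists_forall_sum_map_layer_le (hj : IsUniversalCompletion j) {a : ℕ → E} (r : ℕ → E)
    (ha : ∀ n, 0 ≤ a n) : ∃ u, ∀ s : Finset ℕ, ∑ n ∈ s, j (layer r n (a n)) ≤ u := by
  refine hj.laterally_complete.exists_forall_sum_le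
    (fun n => hj.map_nonneg (layer_nonneg r (ha n) n)) fun m n hmn => ?_
  change j (layer r m (a m)) ⊓ j (layer r n (a n)) = 0
  rw [← hj.map_inf, layer_inf_layer_eq_zero r (ha m) (ha n) hmn, map_zero]

/-- The hypothesis `(x - a n)⁺ ∈ {r n}ᵈ` means that `x ≤ a n` on the band generated by `r n`. -/
theorem exists_forall_map_le (hj : IsUniversalCompletion j) {a r : ℕ → E} (ha : ∀ n, 0 ≤ a n)
    (hr : disjointComplement (Set.range r) = ⊥) :
    ∃ u, ∀ x, 0 ≤ x → (∀ n, (x - a n)⁺ ∈ disjointComplement {r n}) → j x ≤ u := by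
  obtain ⟨u, hu⟩ := hj.exists_forall_sum_map_layer_le r ha
  refine ⟨u, fun x hx hxa => ?_⟩
  have hle (N : ℕ) : j x - u ≤ j (residual r N x) := by
    rw [sub_le_comm, ← map_sub, ← sum_layer_apply, map_sum]
    exact (Finset.sum_le_sum fun n _ =>
      hj.map_le_map_iff.2 (layer_le_layer_of_posPart_sub_mem (hxa n))).trans (hu _)
  exact sub_nonpos.1 ((hj.isGLB_map_zero (isGLB_residual hr hx)).2 (Set.forall_mem_range.2 hle))

end IsUniversalCompletion

theorem SupCompletion.sup_of {U : Type*} [ConditionallyCompleteLattice U] {ι : Type*}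
    [Nonempty ι] {u : ι → U} (hu : BddAbove (Set.range u)) :
    sup (fun i => of (u i)) = of (⨆ i, u i) := by
  refine (isLUB_sup _).unique ⟨Set.forall_mem_range.2 fun i => of_le_of.2 (le_ciSup hu i), ?_⟩
  intro y hy
  have hmem : Set.range u ⊆ y.carrier := Set.range_subset_iff.2 fun i => of_le_iff.1 (hy ⟨i, rfl⟩)
  exact of_le_iff.2 (y.sup_mem _ _ hmem (Set.range_nonempty u) (isLUB_ciSup hu))

end UniversalCompletion

end RieszSpace

theorem mainTheorem6_general {E U : Type*}
    [ConditionallyCompleteLattice E] [AddCommGroup E] [IsOrderedAddMonoid E]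
    [Module ℝ E] [IsOrderedModule ℝ E]
    [ConditionallyCompleteLattice U] [AddCommGroup U] [IsOrderedAddMonoid U] [Module ℝ U]
    {j : E →ₗ[ℝ] U} (hj : RieszSpace.IsUniversalCompletion j)
    {T : E →ₗ[ℝ] E} {S : ℕ → E →ₗ[ℝ] E} (hS : RieszSpace.IsFiltration T S)
    {f : ℕ → E} (hf : RieszSpace.IsSubmartingale S fun n => |f n|)
    (hbdd : RieszSpace.IsTBounded T f) :
    RieszSpace.maximalFunction j f ∈ Set.range (RieszSpace.SupCompletion.of (U := U)) := by
  have hT := hS.isConditionalExpectation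
  obtain ⟨e, he, hTe⟩ := hT.exists_fixed_unit
  obtain ⟨M, hM⟩ := hbdd
  have hne₀ (n : ℕ) : 0 ≤ n • e := nsmul_nonneg he.1 n
  have hTne (n : ℕ) : T (n • e) = n • e := by rw [map_nsmul, hTe]
  choose r hr₀ hr hTr hdisj using fun n : ℕ =>
    hf.exists_forall_posPart_sub_mem_disjointComplement hS (fun i => abs_nonneg (f i)) hM
      (hne₀ n) (hTne n)
  have hbot := hT.disjointComplement_range_eq_bot he hr₀ hr hTr
  obtain ⟨u, hu⟩ := hj.exists_forall_map_le hne₀ hbot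
  have hfu (i : ℕ) : |j (f i)| ≤ u := by
    rw [← hj.map_abs]
    exact hu _ (abs_nonneg (f i)) fun n => hdisj n i
  exact ⟨⨆ i, |j (f i)|,
    (RieszSpace.SupCompletion.sup_of ⟨u, Set.forall_mem_range.2 hfu⟩).symm⟩

theorem mainTheorem6 {E U : Type*}
    [ConditionallyCompleteLattice E] [AddCommGroup E] [IsOrderedAddMonoid E]
    [Module ℝ E] [IsOrderedModule ℝ E]
    [ConditionallyCompleteLattice U] [AddCommGroup U] [IsOrderedAddMonoid U]
    [Module ℝ U] [IsOrderedModule ℝ U]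
    (j : E →ₗ[ℝ] U) (hj : RieszSpace.IsUniversalCompletion j)
    (e : E) (he : RieszSpace.IsWeakOrderUnit e)
    (T : E →ₗ[ℝ] E) (hT : RieszSpace.IsConditionalExpectation T) (hTe : T e = e)
    (S : ℕ → E →ₗ[ℝ] E) (hS : RieszSpace.IsFiltration T S)
    (f : ℕ → E) (hf : RieszSpace.IsMartingale S f) (hbdd : RieszSpace.IsTBounded T f) :
    RieszSpace.maximalFunction j f ∈ Set.range (RieszSpace.SupCompletion.of (U := U)) := by
  exact mainTheorem6_general hj hS (hf.isSubmartingale_abs hS) hbdd
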